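/- **Setting.** A *higher order signature* $\Sigma$ consists of a set $|\Sigma|$ of basic types, a distinguished $\mathsf{Prop}\in|\Sigma|$, and a set of function symbols $f:\sigma_1,\dots,\sigma_n\to\sigma_{n+1}$ for all basic types $\sigma_1,\dots,\sigma_{n+1}$. Types are generated from basic types and $1$ by $\sigma\times\tau$ and $\sigma\to\tau$. Terms in context, $\Gamma\vdash M:\tau$ (up to renaming of bound variables), are generated by variables, function symbols, $()$, pairs and projections, $\lambda$-abstraction and application, and, at type $\mathsf{Prop}$, by $M=_\sigma N$, $\top,\bot,\wedge,\vee,\Rightarrow$, $\forall_{x:\sigma},\exists_{x:\sigma}$ (all types $\sigma$), $\mathcal C(\varphi)$ and $\varphi\,\mathcal U\,\psi$; $\neg\varphi$ is $\varphi\Rightarrow\bot$. *Higher order SLCS* derives sequents $\Gamma\mid\Phi\vdash\psi$ ($\Phi$ a finite set of terms of type $\mathsf{Prop}$ in context $\Gamma$) by: the structural rules (axiom, weakening, cut, substitution of terms for variables); the usual intuitionistic rules for connectives and quantifiers; reflexivity and replacement for $=_\sigma$; the equations $(\lambda v.M)N=M[N/v]$, $\lambda v.M(v)=M$ ($v$ not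 free in $M$), $M=_1()$, $\pi_1(M,N)=M$, $\pi_2(M,N)=N$, $(\pi_1P,\pi_2P)=P$; the rule "from $\Gamma,v:\sigma\mid\ \vdash M=N$ infer $\Gamma\mid\ \vdash\lambda v.M=\lambda v.N$"; the rule "from $\Gamma\mid\varphi\vdash\psi$ and $\Gamma\mid\psi\vdash\varphi$ infer $\Gamma\mid\ \vdash\varphi=_{\mathsf{Prop}}\psi$"; and $$\frac{\Gamma\mid\Phi\vdash\psi}{\Gamma\mid\Phi\vdash\mathcal C(\psi)}\qquad\frac{\Gamma\mid\Phi,\psi\vdash\varphi}{\Gamma\mid\Phi,\mathcal C(\psi)\vdash\mathcal C(\varphi)}\qquad\frac{\Gamma\mid\Phi,\chi\vdash\varphi\quad\Gamma\mid\Phi,\mathcal C(\chi),\neg\chi\vdash\psi}{\Gamma\mid\Phi,\chi\vdash\varphi\,\mathcal U\,\psi}$$ $$\frac{\Gamma\mid\Phi,\ \chi\Rightarrow\varphi,\ (\mathcal C(\chi)\wedge\neg\chi)\Rightarrow\psi,\ \chi\vdash\theta\quad\text{for all }\chi\text{ with }\Gamma\vdash\chi:\mathsf{Prop}}{\Gamma\mid\Phi,\varphi\,\mathcal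 U\,\psi\vdash\theta}$$ The *classifying category* $\mathbf{Cl}(\Sigma)$ has the types as objects; its morphisms $\sigma\to\tau$ are the elements of $\mathrm{Term}(\sigma,\tau)$, the set of terms $x:\sigma\vdash M:\tau$ modulo provable equality ($M\sim N$ iff $x:\sigma\mid\ \vdash M=_\tau N$ is derivable); composition is substitution. An *elementary closure hyperdoctrine* $(\mathscr P,\mathfrak c)$ on a category $\mathbf C$ with finite products is a functor $\mathscr P:\mathbf C^{op}\to\mathbf{HA}$ to Heyting algebras such that: reindexing along each projection $D\times C\to C$ has a left adjoint $\exists$ and a right adjoint $\forall$, both satisfying the Beck–Chevalley condition, and $\exists$ satisfying Frobenius reciprocity; each object $C$ has a fibered equality $\delta_C\in\mathscr P(C\times C)$, i.e. for all $D$ the map $\mathscr P_{(\pi_1,\pi_2)}(-)\wedge\mathscr P_{(\pi_2,\pi_3)}(\delta_C)$ is left adjoint to $\mathscr P_{1_D\times\Delta_C}$; and $\mathfrak c$ is a family of monotone, inflationary maps $\mathfrak c_C:\mathscr P(C)\to\mathscr P(C)$ with $\mathfrak c_C\circ\mathscr P_f\le\mathscr P_f\circ\mathfrak c_D$ for all $f:C\to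 D$. A *morphism* $(\mathscr P,\mathfrak c)\to(\mathscr Q,\mathfrak d)$ is a finite product preserving functor $\mathscr F$ with a natural transformation $\eta:\mathscr P\to\mathscr Q\circ\mathscr F^{op}$ of Heyting algebra valued functors that preserves $\exists$, $\forall$ and $\delta$ (modulo $\mathscr F(C\times D)\cong\mathscr F(C)\times\mathscr F(D)$) and satisfies $\mathfrak d_{\mathscr F(C)}\circ\eta_C\le\eta_C\circ\mathfrak c_C$; it is *open* if equality holds. Let $\mathfrak c_\Sigma$ be $[\varphi]\mapsto[\mathcal C(\varphi)]$. A *model* of higher order SLCS in an elementary closure hyperdoctrine $(\mathscr P,\mathfrak c)$ on a cartesian closed category $\mathbf C$, with $\mathscr P$ isomorphic (as a set valued functor) to $\mathbf C(-,C)$ for an object $C$, is an open morphism $(\mathscr M,\mu):(\mathrm{Term}(-,\mathsf{Prop}),\mathfrak c_\Sigma)\to(\mathscr P,\mathfrak c)$ such that $\mathscr M(\mathsf{Prop})\cong C$ and $\mathscr M$ preserves exponentials. It *satisfies* $x:\sigma\mid\Phi\vdash\psi$ if $\bigwedge_{\varphi\in\Phi}\mu_\sigma([\varphi])\le\mu_\sigma([\psi])$;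 it satisfies a sequent in a context $x_1:\sigma_1,\dots,x_n:\sigma_n$ if it satisfies the sequent over the product of the types $\sigma_1,\dots,\sigma_n$ that is obtained by substituting the projections for the variables. **Theorem.** Let $\Sigma$ be a higher order signature. 1. $\mathbf{Cl}(\Sigma)$ is cartesian closed. 2. $(\mathrm{Term}(-,\mathsf{Prop}),\mathfrak c_\Sigma)$, with fibre over $\sigma$ ordered by derivability, is an elementary closure hyperdoctrine on $\mathbf{Cl}(\Sigma)$, whose fibered equality on $\sigma$ is $[\pi_1(x)=_\sigma\pi_2(x)]$; and for all $x:\sigma\vdash\varphi,\psi:\mathsf{Prop}$, $[\varphi]\le[\psi]$ iff $x:\sigma\mid\varphi\vdash\psi$ is derivable. 3. The identities $(1_{\mathbf{Cl}(\Sigma)},1_{\mathrm{Term}(-,\mathsf{Prop})})$ form a model (the *generic model*), and a sequent $\Gamma\mid\Phi\vdash\psi$ is satisfied by it if and only if it is derivable. 4. (Soundness and completeness) A derivable sequent is satisfied by every model, and a sequent satisfied by every model is derivable. -/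

import Mathlib

open CategoryTheory Opposite MonoidalCategory CartesianMonoidalCategory Limits

universe w u

namespace SLCS

/-! ### Higher order signatures, types and terms -/

/-- A higher order signature: a set of basic types, a distinguished basic type `Prop`, and for
every list of basic types `σ₁, …, σₙ` and basic type `σₙ₊₁` a set of function symbols
`σ₁, …, σₙ → σₙ₊₁`. -/
structure Signature where
  Base : Type u
  propBase : Base
  Fn : List Base → Base → Type u

/-- The types over a signature. -/
inductive Ty (S : Signature.{u}) : Type u
  | base : S.Base → Ty S
  | unit : Ty S
  | prod : Ty S → Ty S → Ty S
  | arr : Ty S → Ty S → Ty S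

/-- The type of propositions. -/
abbrev Ty.prop (S : Signature.{u}) : Ty S := .base S.propBase

variable {S : Signature.{u}}

/-- Contexts are lists of types; variables are de Bruijn indices, so that terms are taken up to
renaming of bound variables. -/
inductive Var : List (Ty S) → Ty S → Type u
  | z {Γ : List (Ty S)} {σ : Ty S} : Var (σ :: Γ) σ
  | s {Γ : List (Ty S)} {σ τ : Ty S} : Var Γ σ → Var (τ :: Γ) σ

/-- `Tm Γ τ` is the set of terms `M` with `Γ ⊢ M : τ`.  The binders `lam`, `all` and `ex` bind the
first variable of the extended context. -/
inductive Tm : List (Ty S) → Ty S → Type u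
  | var {Γ : List (Ty S)} {τ : Ty S} : Var Γ τ → Tm Γ τ
  | fn {Γ : List (Ty S)} {as : List S.Base} {b : S.Base} (f : S.Fn as b)
      (args : ∀ i : Fin as.length, Tm Γ (.base (as.get i))) : Tm Γ (.base b)
  | star {Γ : List (Ty S)} : Tm Γ .unit
  | pair {Γ : List (Ty S)} {σ τ : Ty S} : Tm Γ σ → Tm Γ τ → Tm Γ (.prod σ τ)
  | fst {Γ : List (Ty S)} {σ τ : Ty S} : Tm Γ (.prod σ τ) → Tm Γ σ
  | snd {Γ : List (Ty S)} {σ τ : Ty S} : Tm Γ (.prod σ τ) → Tm Γ τ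
  | lam {Γ : List (Ty S)} {σ τ : Ty S} : Tm (σ :: Γ) τ → Tm Γ (.arr σ τ)
  | app {Γ : List (Ty S)} {σ τ : Ty S} : Tm Γ (.arr σ τ) → Tm Γ σ → Tm Γ τ
  | eq {Γ : List (Ty S)} {σ : Ty S} : Tm Γ σ → Tm Γ σ → Tm Γ (.prop S)
  | top {Γ : List (Ty S)} : Tm Γ (.prop S)
  | bot {Γ : List (Ty S)} : Tm Γ (.prop S)
  | and {Γ : List (Ty S)} : Tm Γ (.prop S) → Tm Γ (.prop S) → Tm Γ (.prop S)
  | or {Γ : List (Ty S)} : Tm Γ (.prop S) → Tm Γ (.prop S) → Tm Γ (.prop S)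
  | imp {Γ : List (Ty S)} : Tm Γ (.prop S) → Tm Γ (.prop S) → Tm Γ (.prop S)
  | all {Γ : List (Ty S)} {σ : Ty S} : Tm (σ :: Γ) (.prop S) → Tm Γ (.prop S)
  | ex {Γ : List (Ty S)} {σ : Ty S} : Tm (σ :: Γ) (.prop S) → Tm Γ (.prop S)
  | cl {Γ : List (Ty S)} : Tm Γ (.prop S) → Tm Γ (.prop S)
  | unt {Γ : List (Ty S)} : Tm Γ (.prop S) → Tm Γ (.prop S) → Tm Γ (.prop S)

/-- Formulae in context: terms of type `Prop`. -/
abbrev Fm (Γ : List (Ty S)) : Type u := Tm Γ (.prop S)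

/-- Negation. -/
abbrev Tm.neg {Γ : List (Ty S)} (φ : Fm Γ) : Fm Γ := .imp φ .bot

/-! ### Renaming and simultaneous substitution -/

/-- Renamings of the variables of `Γ` by variables of `Δ`. -/
abbrev Ren (Δ Γ : List (Ty S)) : Type u := ∀ ⦃τ : Ty S⦄, Var Γ τ → Var Δ τ

/-- Simultaneous substitutions of terms in context `Δ` for the variables of `Γ`. -/
abbrev Sub (Δ Γ : List (Ty S)) : Type u := ∀ ⦃τ : Ty S⦄, Var Γ τ → Tm Δ τ

/-- Extension of a renaming under a binder. -/
def Ren.lift {Δ Γ : List (Ty S)} (r : Ren Δ Γ) (σ : Ty S) : Ren (σ :: Δ) (σ :: Γ)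
  | _, .z => .z
  | _, .s v => .s (r v)

/-- Renaming of a term. -/
def Tm.ren {Γ : List (Ty S)} {τ : Ty S} (M : Tm Γ τ) {Δ : List (Ty S)} (r : Ren Δ Γ) : Tm Δ τ :=
  match M with
  | .var v => .var (r v)
  | .fn f args => .fn f fun i => (args i).ren r
  | .star => .star
  | .pair M N => .pair (M.ren r) (N.ren r)
  | .fst M => .fst (M.ren r)
  | .snd M => .snd (M.ren r)
  | .lam M => .lam (M.ren (r.lift _))
  | .app M N => .app (M.ren r) (N.ren r)
  | .eq M N => .eq (M.ren r) (N.ren r)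
  | .top => .top
  | .bot => .bot
  | .and φ ψ => .and (φ.ren r) (ψ.ren r)
  | .or φ ψ => .or (φ.ren r) (ψ.ren r)
  | .imp φ ψ => .imp (φ.ren r) (ψ.ren r)
  | .all φ => .all (φ.ren (r.lift _))
  | .ex φ => .ex (φ.ren (r.lift _))
  | .cl φ => .cl (φ.ren r)
  | .unt φ ψ => .unt (φ.ren r) (ψ.ren r)

/-- Weakening of a term by one fresh variable. -/
abbrev Tm.wk {Γ : List (Ty S)} {τ : Ty S} (M : Tm Γ τ) (σ : Ty S) : Tm (σ :: Γ) τ :=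
  M.ren fun _ v => .s v

/-- Extension of a substitution under a binder. -/
def Sub.lift {Δ Γ : List (Ty S)} (s : Sub Δ Γ) (σ : Ty S) : Sub (σ :: Δ) (σ :: Γ)
  | _, .z => .var .z
  | _, .s v => (s v).wk σ

/-- Capture avoiding simultaneous substitution. -/
def Tm.subst {Γ : List (Ty S)} {τ : Ty S} (M : Tm Γ τ) {Δ : List (Ty S)} (s : Sub Δ Γ) : Tm Δ τ :=
  match M with
  | .var v => s v
  | .fn f args => .fn f fun i => (args i).subst s
  | .star => .star
  | .pair M N => .pair (M.subst s) (N.subst s)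
  | .fst M => .fst (M.subst s)
  | .snd M => .snd (M.subst s)
  | .lam M => .lam (M.subst (s.lift _))
  | .app M N => .app (M.subst s) (N.subst s)
  | .eq M N => .eq (M.subst s) (N.subst s)
  | .top => .top
  | .bot => .bot
  | .and φ ψ => .and (φ.subst s) (ψ.subst s)
  | .or φ ψ => .or (φ.subst s) (ψ.subst s)
  | .imp φ ψ => .imp (φ.subst s) (ψ.subst s)
  | .all φ => .all (φ.subst (s.lift _))
  | .ex φ => .ex (φ.subst (s.lift _))
  | .cl φ => .cl (φ.subst s)
  | .unt φ ψ => .unt (φ.subst s) (ψ.subst s)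

/-- The substitution on the empty context. -/
def Sub.nil {Δ : List (Ty S)} : Sub Δ ([] : List (Ty S)) := fun _ v => nomatch v

/-- The substitution `s, M`. -/
def Sub.cons {Δ Γ : List (Ty S)} {σ : Ty S} (s : Sub Δ Γ) (M : Tm Δ σ) : Sub Δ (σ :: Γ)
  | _, .z => M
  | _, .s v => s v

/-- The substitution `[M | x]` for the only variable of a one variable context `x : σ`. -/
abbrev Sub.one {Δ : List (Ty S)} {σ : Ty S} (M : Tm Δ σ) : Sub Δ [σ] := Sub.nil.cons M

/-- `M.inst N` is `M[N | x]` for the first variable `x` of the context. -/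
abbrev Tm.inst {Γ : List (Ty S)} {σ τ : Ty S} (M : Tm (σ :: Γ) τ) (N : Tm Γ σ) : Tm Γ τ :=
  M.subst (Sub.cons (fun _ v => .var v) N)

/-! ### Derivable sequents -/

/-- `Der Γ Φ φ`: the sequent `Γ ∣ Φ ⊢ φ` is derivable in higher order SLCS.  The finite set `Φ` is
given by a list, whose order and repetitions are irrelevant by the rule `weak`. -/
inductive Der : (Γ : List (Ty S)) → List (Fm Γ) → Fm Γ → Prop
  -- structural rules
  | ax {Γ : List (Ty S)} {Φ : List (Fm Γ)} {φ : Fm Γ} : φ ∈ Φ → Der Γ Φ φ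
  | weak {Γ : List (Ty S)} {Φ Ψ : List (Fm Γ)} {φ : Fm Γ} : Φ ⊆ Ψ → Der Γ Φ φ → Der Γ Ψ φ
  | cut {Γ : List (Ty S)} {Φ : List (Fm Γ)} {φ ψ : Fm Γ} :
      Der Γ Φ φ → Der Γ (φ :: Φ) ψ → Der Γ Φ ψ
  | subst {Γ Δ : List (Ty S)} {Φ : List (Fm Γ)} {φ : Fm Γ} (s : Sub Δ Γ) :
      Der Γ Φ φ → Der Δ (Φ.map fun χ => χ.subst s) (φ.subst s)
  -- intuitionistic connectives
  | top_intro {Γ : List (Ty S)} {Φ : List (Fm Γ)} : Der Γ Φ .top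
  | bot_elim {Γ : List (Ty S)} {Φ : List (Fm Γ)} {φ : Fm Γ} : Der Γ Φ .bot → Der Γ Φ φ
  | and_intro {Γ : List (Ty S)} {Φ : List (Fm Γ)} {φ ψ : Fm Γ} :
      Der Γ Φ φ → Der Γ Φ ψ → Der Γ Φ (.and φ ψ)
  | and_left {Γ : List (Ty S)} {Φ : List (Fm Γ)} {φ ψ : Fm Γ} : Der Γ Φ (.and φ ψ) → Der Γ Φ φ
  | and_right {Γ : List (Ty S)} {Φ : List (Fm Γ)} {φ ψ : Fm Γ} : Der Γ Φ (.and φ ψ) → Der Γ Φ ψ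
  | or_left {Γ : List (Ty S)} {Φ : List (Fm Γ)} {φ ψ : Fm Γ} : Der Γ Φ φ → Der Γ Φ (.or φ ψ)
  | or_right {Γ : List (Ty S)} {Φ : List (Fm Γ)} {φ ψ : Fm Γ} : Der Γ Φ ψ → Der Γ Φ (.or φ ψ)
  | or_elim {Γ : List (Ty S)} {Φ : List (Fm Γ)} {φ ψ θ : Fm Γ} :
      Der Γ Φ (.or φ ψ) → Der Γ (φ :: Φ) θ → Der Γ (ψ :: Φ) θ → Der Γ Φ θ
  | imp_intro {Γ : List (Ty S)} {Φ : List (Fm Γ)} {φ ψ : Fm Γ} :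
      Der Γ (φ :: Φ) ψ → Der Γ Φ (.imp φ ψ)
  | imp_elim {Γ : List (Ty S)} {Φ : List (Fm Γ)} {φ ψ : Fm Γ} :
      Der Γ Φ (.imp φ ψ) → Der Γ Φ φ → Der Γ Φ ψ
  -- quantifiers over all types
  | all_intro {Γ : List (Ty S)} {σ : Ty S} {Φ : List (Fm Γ)} {φ : Fm (σ :: Γ)} :
      Der (σ :: Γ) (Φ.map fun χ => χ.wk σ) φ → Der Γ Φ (.all φ)
  | all_elim {Γ : List (Ty S)} {σ : Ty S} {Φ : List (Fm Γ)} {φ : Fm (σ :: Γ)} (M : Tm Γ σ) :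
      Der Γ Φ (.all φ) → Der Γ Φ (φ.inst M)
  | ex_intro {Γ : List (Ty S)} {σ : Ty S} {Φ : List (Fm Γ)} {φ : Fm (σ :: Γ)} (M : Tm Γ σ) :
      Der Γ Φ (φ.inst M) → Der Γ Φ (.ex φ)
  | ex_elim {Γ : List (Ty S)} {σ : Ty S} {Φ : List (Fm Γ)} {φ : Fm (σ :: Γ)} {θ : Fm Γ} :
      Der Γ Φ (.ex φ) → Der (σ :: Γ) (φ :: Φ.map fun χ => χ.wk σ) (θ.wk σ) → Der Γ Φ θ
  -- equality: reflexivity and replacement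
  | eq_refl {Γ : List (Ty S)} {σ : Ty S} {Φ : List (Fm Γ)} (M : Tm Γ σ) : Der Γ Φ (.eq M M)
  | eq_subst {Γ : List (Ty S)} {σ : Ty S} {Φ : List (Fm Γ)} {M N : Tm Γ σ} (φ : Fm (σ :: Γ)) :
      Der Γ Φ (.eq M N) → Der Γ Φ (φ.inst M) → Der Γ Φ (φ.inst N)
  -- conversions of the typed lambda calculus
  | beta {Γ : List (Ty S)} {σ τ : Ty S} {Φ : List (Fm Γ)} (M : Tm (σ :: Γ) τ) (N : Tm Γ σ) :
      Der Γ Φ (.eq (.app (.lam M) N) (M.inst N))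
  | eta {Γ : List (Ty S)} {σ τ : Ty S} {Φ : List (Fm Γ)} (M : Tm Γ (.arr σ τ)) :
      Der Γ Φ (.eq (.lam (.app (M.wk σ) (.var .z))) M)
  | xi {Γ : List (Ty S)} {σ τ : Ty S} {M N : Tm (σ :: Γ) τ} :
      Der (σ :: Γ) [] (.eq M N) → Der Γ [] (.eq (.lam M) (.lam N))
  | unit_eta {Γ : List (Ty S)} {Φ : List (Fm Γ)} (M : Tm Γ .unit) : Der Γ Φ (.eq M .star)
  | fst_pair {Γ : List (Ty S)} {σ τ : Ty S} {Φ : List (Fm Γ)} (M : Tm Γ σ) (N : Tm Γ τ) :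
      Der Γ Φ (.eq (.fst (.pair M N)) M)
  | snd_pair {Γ : List (Ty S)} {σ τ : Ty S} {Φ : List (Fm Γ)} (M : Tm Γ σ) (N : Tm Γ τ) :
      Der Γ Φ (.eq (.snd (.pair M N)) N)
  | pair_eta {Γ : List (Ty S)} {σ τ : Ty S} {Φ : List (Fm Γ)} (M : Tm Γ (.prod σ τ)) :
      Der Γ Φ (.eq (.pair (.fst M) (.snd M)) M)
  -- provably equivalent propositions are provably equal
  | prop_ext {Γ : List (Ty S)} {φ ψ : Fm Γ} :
      Der Γ [φ] ψ → Der Γ [ψ] φ → Der Γ [] (.eq φ ψ)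
  -- the closure operator
  | cl_one {Γ : List (Ty S)} {Φ : List (Fm Γ)} {ψ : Fm Γ} : Der Γ Φ ψ → Der Γ Φ (.cl ψ)
  | cl_two {Γ : List (Ty S)} {Φ : List (Fm Γ)} {ψ φ : Fm Γ} :
      Der Γ (ψ :: Φ) φ → Der Γ (.cl ψ :: Φ) (.cl φ)
  -- the until (surroundedness) operator; its elimination rule has one premise for each `χ`
  | unt_intro {Γ : List (Ty S)} {Φ : List (Fm Γ)} {χ φ ψ : Fm Γ} :
      Der Γ (χ :: Φ) φ → Der Γ (.cl χ :: .neg χ :: Φ) ψ → Der Γ (χ :: Φ) (.unt φ ψ)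
  | unt_elim {Γ : List (Ty S)} {Φ : List (Fm Γ)} {φ ψ θ : Fm Γ} :
      (∀ χ : Fm Γ, Der Γ (χ :: .imp χ φ :: .imp (.and (.cl χ) (.neg χ)) ψ :: Φ) θ) →
        Der Γ (.unt φ ψ :: Φ) θ

/-! ### Substitution lemmas -/

theorem Tm.subst_var {Γ : List (Ty S)} {τ : Ty S} (M : Tm Γ τ) :
    M.subst (fun _ v => .var v) = M := by
  have hl : ∀ (Γ : List (Ty S)) (σ : Ty S),
      Sub.lift (fun _ v => .var v : Sub Γ Γ) σ = fun _ v => .var v := by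
    intro Γ σ; funext τ v; cases v <;> rfl
  induction M with
  | lam M ih | all M ih | ex M ih => simp only [Tm.subst, hl, ih]
  | fn f args ih => simp only [Tm.subst, ih]
  | pair M N ihM ihN | app M N ihM ihN | eq M N ihM ihN | and M N ihM ihN | or M N ihM ihN
  | imp M N ihM ihN | unt M N ihM ihN => simp only [Tm.subst, ihM, ihN]
  | fst M ih | snd M ih | cl M ih => simp only [Tm.subst, ih]
  | var v | star | top | bot => rfl

theorem Tm.subst_ren {Γ Δ E : List (Ty S)} {τ : Ty S} (M : Tm Γ τ) (r : Ren Δ Γ) (s : Sub E Δ) :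
    (M.ren r).subst s = M.subst (fun _ v => s (r v)) := by
  have hl : ∀ (Γ Δ E : List (Ty S)) (r : Ren Δ Γ) (s : Sub E Δ) (σ : Ty S),
      (fun τ (v : Var (σ :: Γ) τ) => s.lift σ (r.lift σ v)) = Sub.lift (fun _ v => s (r v)) σ := by
    intro Γ Δ E r s σ; funext τ v; cases v <;> rfl
  induction M generalizing Δ E with
  | lam M ih | all M ih | ex M ih => simp only [Tm.subst, Tm.ren, ih, hl]
  | fn f args ih => simp only [Tm.subst, Tm.ren, ih]
  | pair M N ihM ihN | app M N ihM ihN | eq M N ihM ihN | and M N ihM ihN | or M N ihM ihN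
  | imp M N ihM ihN | unt M N ihM ihN => simp only [Tm.subst, Tm.ren, ihM, ihN]
  | fst M ih | snd M ih | cl M ih => simp only [Tm.subst, Tm.ren, ih]
  | var v | star | top | bot => rfl

theorem Tm.ren_ren {Γ Δ E : List (Ty S)} {τ : Ty S} (M : Tm Γ τ) (r : Ren Δ Γ) (s : Ren E Δ) :
    (M.ren r).ren s = M.ren (fun _ v => s (r v)) := by
  have hl : ∀ (Γ Δ E : List (Ty S)) (r : Ren Δ Γ) (s : Ren E Δ) (σ : Ty S),
      (fun τ (v : Var (σ :: Γ) τ) => s.lift σ (r.lift σ v)) = Ren.lift (fun _ v => s (r v)) σ := by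
    intro Γ Δ E r s σ; funext τ v; cases v <;> rfl
  induction M generalizing Δ E with
  | lam M ih | all M ih | ex M ih => simp only [Tm.ren, ih, hl]
  | fn f args ih => simp only [Tm.ren, ih]
  | pair M N ihM ihN | app M N ihM ihN | eq M N ihM ihN | and M N ihM ihN | or M N ihM ihN
  | imp M N ihM ihN | unt M N ihM ihN => simp only [Tm.ren, ihM, ihN]
  | fst M ih | snd M ih | cl M ih => simp only [Tm.ren, ih]
  | var v | star | top | bot => rfl

theorem Tm.ren_subst {Γ Δ E : List (Ty S)} {τ : Ty S} (M : Tm Γ τ) (s : Sub Δ Γ) (r : Ren E Δ) :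
    (M.subst s).ren r = M.subst (fun _ v => (s v).ren r) := by
  have hl : ∀ (Γ Δ E : List (Ty S)) (s : Sub Δ Γ) (r : Ren E Δ) (σ : Ty S),
      (fun τ (v : Var (σ :: Γ) τ) => (s.lift σ v).ren (r.lift σ)) =
        Sub.lift (fun _ v => (s v).ren r) σ := by
    intro Γ Δ E s r σ; funext τ v
    cases v with
    | z => rfl
    | s v => simp only [Sub.lift, Tm.wk, Tm.ren_ren]; rfl
  induction M generalizing Δ E with
  | lam M ih | all M ih | ex M ih => simp only [Tm.subst, Tm.ren, ih, hl]
  | fn f args ih => simp only [Tm.subst, Tm.ren, ih]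
  | pair M N ihM ihN | app M N ihM ihN | eq M N ihM ihN | and M N ihM ihN | or M N ihM ihN
  | imp M N ihM ihN | unt M N ihM ihN => simp only [Tm.subst, Tm.ren, ihM, ihN]
  | fst M ih | snd M ih | cl M ih => simp only [Tm.subst, Tm.ren, ih]
  | var v | star | top | bot => rfl

theorem Tm.subst_subst {Γ Δ E : List (Ty S)} {τ : Ty S} (M : Tm Γ τ) (s : Sub Δ Γ) (t : Sub E Δ) :
    (M.subst s).subst t = M.subst (fun _ v => (s v).subst t) := by
  have hl : ∀ (Γ Δ E : List (Ty S)) (s : Sub Δ Γ) (t : Sub E Δ) (σ : Ty S),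
      (fun τ (v : Var (σ :: Γ) τ) => (s.lift σ v).subst (t.lift σ)) =
        Sub.lift (fun _ v => (s v).subst t) σ := by
    intro Γ Δ E s t σ; funext τ v
    cases v with
    | z => rfl
    | s v => simp only [Sub.lift, Tm.wk, Tm.subst_ren, Tm.ren_subst]
  induction M generalizing Δ E with
  | lam M ih | all M ih | ex M ih => simp only [Tm.subst, ih, hl]
  | fn f args ih => simp only [Tm.subst, ih]
  | pair M N ihM ihN | app M N ihM ihN | eq M N ihM ihN | and M N ihM ihN | or M N ihM ihN
  | imp M N ihM ihN | unt M N ihM ihN => simp only [Tm.subst, ihM, ihN]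
  | fst M ih | snd M ih | cl M ih => simp only [Tm.subst, ih]
  | var v | star | top | bot => rfl

theorem Tm.wk_inst {Γ : List (Ty S)} {σ τ : Ty S} (M : Tm Γ τ) (N : Tm Γ σ) :
    (M.wk σ).inst N = M := by
  rw [Tm.inst, Tm.wk, Tm.subst_ren]; exact M.subst_var

theorem Sub.cons_comp {Γ Δ E : List (Ty S)} {σ : Ty S} (s : Sub Δ Γ) (M : Tm Δ σ) (t : Sub E Δ) :
    (fun τ (v : Var (σ :: Γ) τ) => (s.cons M v).subst t) =
      Sub.cons (fun _ v => (s v).subst t) (M.subst t) := by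
  funext τ v; cases v <;> rfl

theorem Sub.one_comp {Δ E : List (Ty S)} {σ : Ty S} (M : Tm Δ σ) (t : Sub E Δ) :
    (fun τ (v : Var [σ] τ) => (Sub.one M v).subst t) = Sub.one (M.subst t) := by
  funext τ v
  cases v with
  | z => rfl
  | s v => cases v

theorem Sub.one_var (σ : Ty S) :
    Sub.one (.var .z : Tm [σ] σ) = fun _ v => .var v := by
  funext τ v
  cases v with
  | z => rfl
  | s v => cases v

theorem Der.eq_congr {Γ : List (Ty S)} {σ τ : Ty S} {Φ : List (Fm Γ)} {M N : Tm Γ σ}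
    (T : Tm (σ :: Γ) τ) (h : Der Γ Φ (.eq M N)) : Der Γ Φ (.eq (T.inst M) (T.inst N)) := by
  have h' := Der.eq_subst (.eq ((T.inst M).wk σ) T) h
  have e : ∀ N : Tm Γ σ, Tm.inst (.eq ((T.inst M).wk σ) T) N = .eq (T.inst M) (T.inst N) := by
    intro N
    change Tm.eq (((T.inst M).wk σ).inst N) (T.inst N) = _
    rw [Tm.wk_inst]
  rw [e, e] at h'
  exact h' (.eq_refl _)

theorem Der.eq_symm {Γ : List (Ty S)} {σ : Ty S} {Φ : List (Fm Γ)} {M N : Tm Γ σ}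
    (h : Der Γ Φ (.eq M N)) : Der Γ Φ (.eq N M) := by
  have h' := Der.eq_subst (.eq (.var .z) (M.wk σ)) h
  have e : ∀ N : Tm Γ σ, Tm.inst (.eq (.var .z) (M.wk σ)) N = .eq N M := by
    intro N
    change Tm.eq N ((M.wk σ).inst N) = _
    rw [Tm.wk_inst]
  rw [e, e] at h'
  exact h' (.eq_refl _)

theorem Der.eq_trans {Γ : List (Ty S)} {σ : Ty S} {Φ : List (Fm Γ)} {M N P : Tm Γ σ}
    (h : Der Γ Φ (.eq M N)) (h₂ : Der Γ Φ (.eq N P)) : Der Γ Φ (.eq M P) := by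
  have h' := Der.eq_subst (.eq (M.wk σ) (.var .z)) h₂
  have e : ∀ N : Tm Γ σ, Tm.inst (.eq (M.wk σ) (.var .z)) N = .eq M N := by
    intro N
    change Tm.eq ((M.wk σ).inst N) N = _
    rw [Tm.wk_inst]
  rw [e, e] at h'
  exact h' h

theorem Der.eq_mp {Γ : List (Ty S)} {Φ : List (Fm Γ)} {φ ψ : Fm Γ}
    (h : Der Γ Φ (.eq φ ψ)) (h₂ : Der Γ Φ φ) : Der Γ Φ ψ :=
  Der.eq_subst (.var .z) h h₂

theorem Der.nil {Γ : List (Ty S)} {Φ : List (Fm Γ)} {φ : Fm Γ} (h : Der Γ [] φ) : Der Γ Φ φ :=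
  .weak (by simp) h

/-- A sequent with one hypothesis may be applied to a derivation of that hypothesis. -/
theorem Der.mp {Γ : List (Ty S)} {Φ : List (Fm Γ)} {φ ψ : Fm Γ} (h : Der Γ [φ] ψ)
    (h₂ : Der Γ Φ φ) : Der Γ Φ ψ :=
  .cut h₂ (.weak (by simp) h)

/-! ### The classifying category -/

/-- Provable equality of terms `x : σ ⊢ M, N : τ`. -/
instance termSetoid (σ τ : Ty S) : Setoid (Tm [σ] τ) where
  r M N := Der [σ] [] (.eq M N)
  iseqv := ⟨fun M => .eq_refl M, fun h => h.eq_symm, fun h h' => h.eq_trans h'⟩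

/-- The set of terms from `σ` to `τ` modulo provable equality. -/
def Term (σ τ : Ty S) : Type u := Quotient (termSetoid σ τ)

/-- The class of a term. -/
def Term.mk {σ τ : Ty S} (M : Tm [σ] τ) : Term σ τ := Quotient.mk _ M

theorem Der.congr_one {Γ : List (Ty S)} {σ τ : Ty S} {Φ : List (Fm Γ)} {M N : Tm Γ σ}
    (T : Tm [σ] τ) (h : Der Γ Φ (.eq M N)) :
    Der Γ Φ (.eq (T.subst (.one M)) (T.subst (.one N))) := by
  have h' := h.eq_congr (T.subst (.one (.var .z)))
  rw [Tm.inst, Tm.inst, Tm.subst_subst, Tm.subst_subst, Sub.one_comp, Sub.one_comp] at h'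
  exact h'

/-- Composition is substitution. -/
def Term.comp {σ τ ρ : Ty S} : Term σ τ → Term τ ρ → Term σ ρ :=
  Quotient.map₂ (fun M N => N.subst (.one M)) fun M _ hM _ N' hN =>
    Der.eq_trans (Der.subst (.one M) hN) (Der.congr_one N' hM)

/-- The classifying category: objects are types, morphisms are terms modulo provable equality. -/
instance : Category.{u} (Ty S) where
  Hom σ τ := Term σ τ
  id _ := Term.mk (.var .z)
  comp := Term.comp
  id_comp f := by
    induction f using Quotient.inductionOn with
    | h M => exact congrArg Term.mk (by beta_reduce; rw [Sub.one_var, Tm.subst_var])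
  comp_id f := by
    induction f using Quotient.inductionOn with
    | h M => rfl
  assoc f g h := by
    induction f using Quotient.inductionOn with
    | h M =>
      induction g using Quotient.inductionOn with
      | h N =>
        induction h using Quotient.inductionOn with
        | h P => exact congrArg Term.mk (by beta_reduce; rw [Tm.subst_subst, Sub.one_comp])

/-- The morphism represented by a term. -/
abbrev hom {σ τ : Ty S} (M : Tm [σ] τ) : σ ⟶ τ := Term.mk M

/-- The type `1` is terminal. -/
def unitIsTerminal : IsTerminal (Ty.unit : Ty S) :=
  IsTerminal.ofUniqueHom (fun _ => hom .star) fun σ f => by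
    induction f using Quotient.inductionOn with
    | h M => exact Quotient.sound (Der.unit_eta M)

/-- The pairing of two classes of terms. -/
def Term.pair {ρ σ τ : Ty S} : Term ρ σ → Term ρ τ → Term ρ (.prod σ τ) :=
  Quotient.map₂ .pair fun M M' hM N N' hN => by
    have h₁ := hM.eq_congr (.pair (.var .z) (N.wk σ))
    have h₂ := hN.eq_congr (.pair (M'.wk τ) (.var .z))
    have e₁ : ∀ P, Tm.inst (.pair (.var .z) (N.wk σ)) P = .pair P N := fun P => by
      change Tm.pair P ((N.wk σ).inst P) = _
      rw [Tm.wk_inst]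
    have e₂ : ∀ P, Tm.inst (.pair (M'.wk τ) (.var .z)) P = .pair M' P := fun P => by
      change Tm.pair ((M'.wk τ).inst P) P = _
      rw [Tm.wk_inst]
    rw [e₁, e₁] at h₁
    rw [e₂, e₂] at h₂
    exact h₁.eq_trans h₂

theorem Term.pair_fst {ρ σ τ : Ty S} (f : ρ ⟶ σ) (g : ρ ⟶ τ) :
    (Term.pair f g : ρ ⟶ .prod σ τ) ≫ hom (.fst (.var .z)) = f := by
  induction f using Quotient.inductionOn with
  | h M =>
    induction g using Quotient.inductionOn with
    | h N => exact Quotient.sound (Der.fst_pair M N)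

theorem Term.pair_snd {ρ σ τ : Ty S} (f : ρ ⟶ σ) (g : ρ ⟶ τ) :
    (Term.pair f g : ρ ⟶ .prod σ τ) ≫ hom (.snd (.var .z)) = g := by
  induction f using Quotient.inductionOn with
  | h M =>
    induction g using Quotient.inductionOn with
    | h N => exact Quotient.sound (Der.snd_pair M N)

theorem Term.pair_eta {ρ σ τ : Ty S} (f : ρ ⟶ .prod σ τ) :
    (Term.pair (f ≫ hom (.fst (.var .z))) (f ≫ hom (.snd (.var .z))) : ρ ⟶ .prod σ τ) = f := by
  induction f using Quotient.inductionOn with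
  | h M => exact Quotient.sound (Der.pair_eta M)

/-- The type `σ × τ` with its two projections is a product of `σ` and `τ`. -/
def prodIsLimit (σ τ : Ty S) :
    IsLimit (BinaryFan.mk (P := Ty.prod σ τ) (hom (.fst (.var .z))) (hom (.snd (.var .z)))) :=
  BinaryFan.isLimitMk (fun s => Term.pair s.fst s.snd) (fun s => Term.pair_fst _ _)
    (fun s => Term.pair_snd _ _) fun s m h₁ h₂ => by
      rw [← h₁, ← h₂]; exact (Term.pair_eta m).symm

/-- Finite products in the classifying category are given by the types `1` and `σ × τ`. -/
instance : CartesianMonoidalCategory (Ty S) :=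
  .ofChosenFiniteProducts ⟨_, unitIsTerminal⟩ fun σ τ => ⟨_, prodIsLimit σ τ⟩

/-! ### The doctrine of terms of type `Prop` -/

/-- The order `[φ] ≤ [ψ]` of predicates is derivability of `x : σ ∣ φ ⊢ ψ`. -/
def Term.le {σ : Ty S} : Term σ (.prop S) → Term σ (.prop S) → Prop :=
  Quotient.lift₂ (fun φ ψ => Der [σ] [φ] ψ) fun φ ψ φ' ψ' hφ hψ => propext
    ⟨fun h => (hψ.nil).eq_mp (h.mp ((Der.nil hφ.eq_symm).eq_mp (.ax (by simp)))),
      fun h => (Der.nil hψ.eq_symm).eq_mp (h.mp ((hφ.nil).eq_mp (.ax (by simp))))⟩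

instance (σ : Ty S) : PartialOrder (Term σ (.prop S)) where
  le := Term.le
  le_refl a := by
    induction a using Quotient.inductionOn with
    | h φ => exact Der.ax (by simp)
  le_trans a b c := by
    induction a using Quotient.inductionOn with
    | h φ =>
      induction b using Quotient.inductionOn with
      | h ψ =>
        induction c using Quotient.inductionOn with
        | h χ => exact fun h₁ h₂ => Der.mp h₂ h₁
  le_antisymm a b := by
    induction a using Quotient.inductionOn with
    | h φ =>
      induction b using Quotient.inductionOn with
      | h ψ => exact fun h₁ h₂ => Quotient.sound (Der.prop_ext h₁ h₂)

theorem Der.eq_iff {Γ : List (Ty S)} {φ ψ : Fm Γ} :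
    Der Γ [] (.eq φ ψ) ↔ Der Γ [φ] ψ ∧ Der Γ [ψ] φ :=
  ⟨fun h => ⟨h.nil.eq_mp (.ax (by simp)), (Der.nil h.eq_symm).eq_mp (.ax (by simp))⟩,
    fun h => .prop_ext h.1 h.2⟩

/-- A connective on predicates. -/
def Term.and {σ : Ty S} : Term σ (.prop S) → Term σ (.prop S) → Term σ (.prop S) :=
  Quotient.map₂ .and fun φ φ' h ψ ψ' h' => by
    have h := Der.eq_iff.1 h
    have h' := Der.eq_iff.1 h'
    exact .prop_ext
      (.and_intro (h.1.mp (.and_left (ψ := ψ) (.ax (by simp))))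
        (h'.1.mp (.and_right (φ := φ) (.ax (by simp)))))
      (.and_intro (h.2.mp (.and_left (ψ := ψ') (.ax (by simp))))
        (h'.2.mp (.and_right (φ := φ') (.ax (by simp)))))

/-- A connective on predicates. -/
def Term.or {σ : Ty S} : Term σ (.prop S) → Term σ (.prop S) → Term σ (.prop S) :=
  Quotient.map₂ .or fun _ _ h _ _ h' => by
    have h := Der.eq_iff.1 h
    have h' := Der.eq_iff.1 h'
    exact .prop_ext
      (.or_elim (.ax (List.mem_singleton_self _)) (.or_left (h.1.mp (.ax (by simp))))
        (.or_right (h'.1.mp (.ax (by simp)))))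
      (.or_elim (.ax (List.mem_singleton_self _)) (.or_left (h.2.mp (.ax (by simp))))
        (.or_right (h'.2.mp (.ax (by simp)))))

/-- A connective on predicates. -/
def Term.imp {σ : Ty S} : Term σ (.prop S) → Term σ (.prop S) → Term σ (.prop S) :=
  Quotient.map₂ .imp fun φ φ' h ψ ψ' h' => by
    have h := Der.eq_iff.1 h
    have h' := Der.eq_iff.1 h'
    exact .prop_ext
      (.imp_intro (h'.1.mp (.imp_elim (φ := φ) (.ax (by simp)) (h.2.mp (.ax (by simp))))))
      (.imp_intro (h'.2.mp (.imp_elim (φ := φ') (.ax (by simp)) (h.1.mp (.ax (by simp))))))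

/-- The predicates over a type form a Heyting algebra. -/
instance (σ : Ty S) : HeytingAlgebra (Term σ (.prop S)) where
  inf := Term.and
  sup := Term.or
  himp := Term.imp
  top := Term.mk .top
  bot := Term.mk .bot
  compl a := Term.imp a (Term.mk .bot)
  himp_bot _ := rfl
  le_top a := by
    induction a using Quotient.inductionOn with
    | h φ => exact Der.top_intro
  bot_le a := by
    induction a using Quotient.inductionOn with
    | h φ => exact Der.bot_elim (.ax (by simp))
  inf_le_left a b := by
    induction a, b using Quotient.inductionOn₂ with
    | h φ ψ => exact Der.and_left (ψ := ψ) (.ax (by simp))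
  inf_le_right a b := by
    induction a, b using Quotient.inductionOn₂ with
    | h φ ψ => exact Der.and_right (φ := φ) (.ax (by simp))
  le_inf a b c := by
    induction a, b, c using Quotient.inductionOn₃ with
    | h φ ψ χ => exact fun h₁ h₂ => Der.and_intro h₁ h₂
  le_sup_left a b := by
    induction a, b using Quotient.inductionOn₂ with
    | h φ ψ => exact Der.or_left (.ax (by simp))
  le_sup_right a b := by
    induction a, b using Quotient.inductionOn₂ with
    | h φ ψ => exact Der.or_right (.ax (by simp))
  sup_le a b c := by
    induction a, b, c using Quotient.inductionOn₃ with
    | h φ ψ χ =>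
      exact fun h₁ h₂ => Der.or_elim (.ax (List.mem_singleton_self _))
        (Der.mp h₁ (.ax (by simp))) (Der.mp h₂ (.ax (by simp)))
  le_himp_iff a b c := by
    induction a, b, c using Quotient.inductionOn₃ with
    | h φ ψ χ =>
      exact ⟨fun h => Der.imp_elim (Der.mp h (.and_left (ψ := ψ) (.ax (by simp))))
          (.and_right (φ := φ) (.ax (by simp))),
        fun h => Der.imp_intro (Der.mp h (.and_intro (.ax (by simp)) (.ax (by simp))))⟩

/-- Substitution along a morphism is a morphism of Heyting algebras. -/
def Term.reindex {σ τ : Ty S} (f : σ ⟶ τ) : HeytingHom (Term τ (.prop S)) (Term σ (.prop S)) where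
  toFun a := Term.comp f a
  map_sup' a b := by
    induction f using Quotient.inductionOn with
    | h M =>
      induction a, b using Quotient.inductionOn₂ with
      | h φ ψ => rfl
  map_inf' a b := by
    induction f using Quotient.inductionOn with
    | h M =>
      induction a, b using Quotient.inductionOn₂ with
      | h φ ψ => rfl
  map_bot' := by
    induction f using Quotient.inductionOn with
    | h M => rfl
  map_himp' a b := by
    induction f using Quotient.inductionOn with
    | h M =>
      induction a, b using Quotient.inductionOn₂ with
      | h φ ψ => rfl

/-- The functor `Term(-, Prop)` from the opposite of the classifying category to Heyting algebras;
on underlying sets it is the representable functor of `Prop`. -/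
def termDoctrine (S : Signature.{u}) : (Ty S)ᵒᵖ ⥤ HeytAlg.{u} where
  obj σ := HeytAlg.of (Term σ.unop (.prop S))
  map f := HeytAlg.ofHom (Term.reindex f.unop)
  map_id σ := by
    ext a
    exact Category.id_comp (X := σ.unop) (Y := Ty.prop S) a
  map_comp {σ τ ρ} f g := by
    ext a
    exact Category.assoc (W := ρ.unop) (X := τ.unop) (Y := σ.unop) (Z := Ty.prop S)
      g.unop f.unop a

/-- The class `[φ]` of a formula `x : σ ⊢ φ : Prop` in the fibre over `σ`. -/
def pred {σ : Ty S} (φ : Fm [σ]) : (termDoctrine S).obj (op σ) := Term.mk φ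

/-- The closure operator `[φ] ↦ [C(φ)]`. -/
def termClosure (S : Signature.{u}) (σ : Ty S) :
    (termDoctrine S).obj (op σ) → (termDoctrine S).obj (op σ) :=
  Quotient.map (sa := termSetoid σ (.prop S)) (sb := termSetoid σ (.prop S)) .cl
    fun _ _ h => .prop_ext (.cl_two (Der.eq_iff.1 h).1) (.cl_two (Der.eq_iff.1 h).2)

/-! ### Closure hyperdoctrines -/

section Doctrines

variable {C : Type w} [Category.{u} C] [CartesianMonoidalCategory C]

/-- A functor to Heyting algebras, on a category with finite products, is a hyperdoctrine if
reindexing along each projection `D × X ⟶ X` has a left and a right adjoint, both satisfying the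
Beck-Chevalley condition, the left one also satisfying Frobenius reciprocity. -/
structure IsHyperdoctrine (P : Cᵒᵖ ⥤ HeytAlg.{u}) : Prop where
  exists_ex : ∃ ex : ∀ D X : C, P.obj (op (D ⊗ X)) → P.obj (op X),
    (∀ D X, GaloisConnection (ex D X) (P.map (snd D X).op)) ∧
    (∀ (D : C) {X X' : C} (f : X' ⟶ X) (β : P.obj (op (D ⊗ X))),
      ex D X' (P.map (D ◁ f).op β) = P.map f.op (ex D X β)) ∧
    (∀ (D X : C) (α : P.obj (op X)) (β : P.obj (op (D ⊗ X))),
      ex D X (P.map (snd D X).op α ⊓ β) = α ⊓ ex D X β)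
  exists_all : ∃ all : ∀ D X : C, P.obj (op (D ⊗ X)) → P.obj (op X),
    (∀ D X, GaloisConnection (P.map (snd D X).op) (all D X)) ∧
    (∀ (D : C) {X X' : C} (f : X' ⟶ X) (β : P.obj (op (D ⊗ X))),
      all D X' (P.map (D ◁ f).op β) = P.map f.op (all D X β))

/-- `δ` is a fibered equality on `X`: for each `D`, the map
`α ↦ P_(π₁,π₂)(α) ∧ P_(π₂,π₃)(δ)` is left adjoint to reindexing along `1_D × Δ_X`. -/
def IsFiberedEquality (P : Cᵒᵖ ⥤ HeytAlg.{u}) (X : C) (δ : P.obj (op (X ⊗ X))) : Prop :=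
  ∀ D : C, GaloisConnection
    (fun α : P.obj (op (D ⊗ X)) => P.map (D ◁ fst X X).op α ⊓ P.map (snd D (X ⊗ X)).op δ)
    (P.map (D ◁ lift (𝟙 X) (𝟙 X)).op)

/-- Closure operators on a doctrine. -/
structure IsClosureOperator (P : Cᵒᵖ ⥤ HeytAlg.{u})
    (c : ∀ X : C, P.obj (op X) → P.obj (op X)) : Prop where
  monotone : ∀ X, Monotone (c X)
  inflationary : ∀ X α, α ≤ c X α
  continuous : ∀ {X Y : C} (f : X ⟶ Y) (α : P.obj (op Y)),
    c X (P.map f.op α) ≤ P.map f.op (c Y α)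

/-- Elementary closure hyperdoctrines. -/
structure IsElementaryClosureHyperdoctrine (P : Cᵒᵖ ⥤ HeytAlg.{u})
    (c : ∀ X : C, P.obj (op X) → P.obj (op X)) : Prop where
  hyperdoctrine : IsHyperdoctrine P
  elementary : ∀ X, ∃ δ, IsFiberedEquality P X δ
  closure : IsClosureOperator P c

variable {D : Type*} [Category.{u} D] [CartesianMonoidalCategory D]

/-- `(F, η)` is a morphism of elementary closure hyperdoctrines.  The components of the natural
transformation `η` are morphisms of Heyting algebras.  In `map_ex` and `map_all`, `b` is the element
that corresponds to `η(a)` under the isomorphism `F(Y × X) ≅ F(Y) × F(X)`. -/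
structure IsMorphism (P : Cᵒᵖ ⥤ HeytAlg.{u}) (c : ∀ X : C, P.obj (op X) → P.obj (op X))
    (Q : Dᵒᵖ ⥤ HeytAlg.{u}) (d : ∀ X : D, Q.obj (op X) → Q.obj (op X))
    (F : C ⥤ D) (η : P ⟶ F.op ⋙ Q) : Prop where
  [preservesFiniteProducts : PreservesFiniteProducts F]
  map_ex : ∀ (Y X : C) (ex : P.obj (op (Y ⊗ X)) → P.obj (op X))
    (ex' : Q.obj (op (F.obj Y ⊗ F.obj X)) → Q.obj (op (F.obj X))),
    GaloisConnection ex (P.map (snd Y X).op) →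
    GaloisConnection ex' (Q.map (snd (F.obj Y) (F.obj X)).op) →
    ∀ (a : P.obj (op (Y ⊗ X))) (b : Q.obj (op (F.obj Y ⊗ F.obj X))),
      Q.map (CartesianMonoidalCategory.prodComparison F Y X).op b = η.app (op (Y ⊗ X)) a →
      η.app (op X) (ex a) = ex' b
  map_all : ∀ (Y X : C) (all : P.obj (op (Y ⊗ X)) → P.obj (op X))
    (all' : Q.obj (op (F.obj Y ⊗ F.obj X)) → Q.obj (op (F.obj X))),
    GaloisConnection (P.map (snd Y X).op) all →
    GaloisConnection (Q.map (snd (F.obj Y) (F.obj X)).op) all' →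
    ∀ (a : P.obj (op (Y ⊗ X))) (b : Q.obj (op (F.obj Y ⊗ F.obj X))),
      Q.map (CartesianMonoidalCategory.prodComparison F Y X).op b = η.app (op (Y ⊗ X)) a →
      η.app (op X) (all a) = all' b
  map_eq : ∀ (X : C) (δ : P.obj (op (X ⊗ X))) (δ' : Q.obj (op (F.obj X ⊗ F.obj X))),
    IsFiberedEquality P X δ → IsFiberedEquality Q (F.obj X) δ' →
    η.app (op (X ⊗ X)) δ = Q.map (CartesianMonoidalCategory.prodComparison F X X).op δ'
  continuous : ∀ (X : C) (α : P.obj (op X)),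
    d (F.obj X) (η.app (op X) α) ≤ η.app (op X) (c X α)

end Doctrines

/-! ### Models and satisfaction -/

section Models

variable {D : Type w} [Category.{u} D] [CartesianMonoidalCategory D]

/-- `(M, μ)` is a model of higher order SLCS in the elementary closure hyperdoctrine `(Q, d)`,
where `Q` is isomorphic to a representable functor on a cartesian closed category. -/
structure IsModel [MonoidalClosed (Ty S)] [MonoidalClosed D]
    (Q : Dᵒᵖ ⥤ HeytAlg.{u}) (d : ∀ X : D, Q.obj (op X) → Q.obj (op X))
    (M : Ty S ⥤ D) (μ : termDoctrine S ⟶ M.op ⋙ Q) : Prop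
    extends IsMorphism (termDoctrine S) (termClosure S) Q d M μ where
  target : IsElementaryClosureHyperdoctrine Q d
  representable : ∃ Ω : D, Nonempty ((Q ⋙ forget HeytAlg).RepresentableBy Ω) ∧
    Nonempty (M.obj (Ty.prop S) ≅ Ω)
  preservesExponentials : MonoidalClosedFunctor M
  isOpen : ∀ (σ : Ty S) (α : (termDoctrine S).obj (op σ)),
    d (M.obj σ) (μ.app (op σ) α) = μ.app (op σ) (termClosure S σ α)

/-- The sequent `x : σ ∣ Φ ⊢ ψ` is satisfied by `(M, μ)`. -/
def Satisfies (Q : Dᵒᵖ ⥤ HeytAlg.{u}) (M : Ty S ⥤ D) (μ : termDoctrine S ⟶ M.op ⋙ Q)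
    (σ : Ty S) (Φ : List (Fm [σ])) (ψ : Fm [σ]) : Prop :=
  (Φ.map fun φ => μ.app (op σ) (pred φ)).foldr (· ⊓ ·) ⊤ ≤ μ.app (op σ) (pred ψ)

/-- The product of the types of a context. -/
def ctxTy : List (Ty S) → Ty S
  | [] => .unit
  | σ :: Γ => .prod (ctxTy Γ) σ

/-- The substitution of the projections of `x : ctxTy Γ` for the variables of `Γ`. -/
def ctxSub : (Γ : List (Ty S)) → Sub [ctxTy Γ] Γ
  | _ :: _, _, .z => .snd (.var .z)
  | _ :: Γ, _, .s v => (ctxSub Γ v).subst (.one (.fst (.var .z)))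

/-- A sequent `Γ ∣ Φ ⊢ ψ` in an arbitrary context is satisfied if the sequent over the product of
the types in `Γ` that corresponds to it is satisfied. -/
def SatisfiesCtx (Q : Dᵒᵖ ⥤ HeytAlg.{u}) (M : Ty S ⥤ D) (μ : termDoctrine S ⟶ M.op ⋙ Q)
    (Γ : List (Ty S)) (Φ : List (Fm Γ)) (ψ : Fm Γ) : Prop :=
  Satisfies Q M μ (ctxTy Γ) (Φ.map fun φ => φ.subst (ctxSub Γ)) (ψ.subst (ctxSub Γ))

/-- The natural transformation of the generic model, with identity components. -/
def genericTrans (S : Signature.{u}) : termDoctrine S ⟶ (𝟭 (Ty S)).op ⋙ termDoctrine S where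
  app σ := 𝟙 ((termDoctrine S).obj σ)

end Models

end SLCS

/-! A type `σ × τ` and a context `x : σ, y : τ` carry the same predicates and terms: substituting
`(x, y)` for a variable of type `σ × τ`, and substituting the projections for `x` and `y`, are
mutually inverse up to provable equality.  The binders `λ`, `∃` and `∀`, which bind a variable of a
context, thereby become operations on morphisms out of a product; their introduction and elimination
rules become the adjunctions that define exponentials and quantifiers, and the compatibility of
binding with substitution becomes naturality and the Beck-Chevalley condition.  In the same way a
sequent in any context is equivalent to one over the product of the types of the context.  In a
fibre of the doctrine of terms the order is derivability, so the generic model satisfies exactly the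
derivable sequents, and every Heyting algebra valued natural transformation out of this doctrine
preserves them. -/

namespace SLCS

/-! ### Doctrines of Heyting algebras -/

section Doctrines

theorem frobenius_of_galoisConnection {A B : Type*} [GeneralizedHeytingAlgebra A]
    [GeneralizedHeytingAlgebra B] {l : B → A} {m : A → B} (gc : GaloisConnection l m)
    (hm : ∀ a b, m (a ⇨ b) = m a ⇨ m b) (a : A) (b : B) : l (m a ⊓ b) = a ⊓ l b := by
  apply le_antisymm
  · exact le_inf (gc.l_le inf_le_left) (gc.monotone_l inf_le_right)
  · have h : b ≤ m a ⇨ m (l (m a ⊓ b)) := by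
      rw [le_himp_iff, inf_comm]
      exact gc.le_u_l _
    rw [inf_comm, ← le_himp_iff]
    exact gc.l_le (by rwa [hm])

variable {C : Type*} [Category.{u} C]

theorem map_op_id_apply (P : Cᵒᵖ ⥤ HeytAlg.{u}) {X : C} (a : P.obj (op X)) :
    P.map (𝟙 X).op a = a := by
  rw [op_id, P.map_id, ConcreteCategory.id_apply]

theorem map_op_comp_apply (P : Cᵒᵖ ⥤ HeytAlg.{u}) {X Y Z : C} (f : X ⟶ Y) (g : Y ⟶ Z)
    (a : P.obj (op Z)) : P.map (f ≫ g).op a = P.map f.op (P.map g.op a) := by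
  rw [op_comp, P.map_comp, ConcreteCategory.comp_apply]

variable [CartesianMonoidalCategory C] {P : Cᵒᵖ ⥤ HeytAlg.{u}} {X : C}
  {δ δ₁ δ₂ : P.obj (op (X ⊗ X))}

theorem IsFiberedEquality.unique (h₁ : IsFiberedEquality P X δ₁) (h₂ : IsFiberedEquality P X δ₂) :
    δ₁ = δ₂ := by
  -- The left adjoints at `D = 1` take `⊤` to the reindexings of `δ₁` and `δ₂` to `1 × (X × X)`.
  have hsnd : P.map (snd (𝟙_ C) (X ⊗ X)).op δ₁ = P.map (snd (𝟙_ C) (X ⊗ X)).op δ₂ := by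
    simpa only [map_top, top_inf_eq] using (h₁ (𝟙_ C)).l_unique (h₂ (𝟙_ C)) (fun _ => rfl) (b := ⊤)
  have hsection := congrArg (P.map (lift (toUnit (X ⊗ X)) (𝟙 (X ⊗ X))).op) hsnd
  simpa only [← map_op_comp_apply, lift_snd, map_op_id_apply] using hsection

theorem IsFiberedEquality.of_refl_of_replacement (hrefl : P.map (lift (𝟙 X) (𝟙 X)).op δ = ⊤)
    (hreplacement : ∀ (D : C) (β : P.obj (op (D ⊗ X ⊗ X))),
      P.map (D ◁ lift (fst X X) (fst X X)).op β ⊓ P.map (snd D (X ⊗ X)).op δ ≤ β) :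
    IsFiberedEquality P X δ := by
  refine fun D α β => ⟨fun h => ?_, fun h => ?_⟩
  · calc α = P.map (D ◁ lift (𝟙 X) (𝟙 X)).op
          (P.map (D ◁ fst X X).op α ⊓ P.map (snd D (X ⊗ X)).op δ) := by
          rw [map_inf, ← map_op_comp_apply, ← map_op_comp_apply, ← whiskerLeft_comp, lift_fst,
            whiskerLeft_id, map_op_id_apply, whiskerLeft_snd, map_op_comp_apply, hrefl, map_top,
            inf_top_eq]
      _ ≤ P.map (D ◁ lift (𝟙 X) (𝟙 X)).op β := OrderHomClass.mono (P.map _).hom h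
  · have hα : P.map (D ◁ fst X X).op α ≤ P.map (D ◁ lift (fst X X) (fst X X)).op β := by
      have hdiag : lift (fst X X) (fst X X) = fst X X ≫ lift (𝟙 X) (𝟙 X) := by
        rw [comp_lift, Category.comp_id]
      rw [hdiag, whiskerLeft_comp, map_op_comp_apply]
      exact OrderHomClass.mono (P.map _).hom h
    exact (inf_le_inf_right _ hα).trans (hreplacement D β)

theorem IsMorphism.of_app_eq_self (c : ∀ X : C, P.obj (op X) → P.obj (op X))
    (η : P ⟶ (𝟭 C).op ⋙ P) (hη : ∀ (X : C) (a : P.obj (op X)), η.app (op X) a = a) :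
    IsMorphism P c P c (𝟭 C) η where
  map_ex Y X ex ex' h h' a b hab := by
    rw [hη, prodComparison_id] at hab
    obtain rfl : b = a := (map_op_id_apply P b).symm.trans hab
    exact (hη X _).trans (h.l_unique h' fun _ => rfl)
  map_all Y X all all' h h' a b hab := by
    rw [hη, prodComparison_id] at hab
    obtain rfl : b = a := (map_op_id_apply P b).symm.trans hab
    exact (hη X _).trans (h.u_unique h' fun _ => rfl)
  map_eq X δ δ' h h' := by
    rw [hη, prodComparison_id]
    exact (h.unique h').trans (map_op_id_apply P δ').symm
  continuous X α := ((congrArg (c X) (hη X α)).trans (hη X (c X α)).symm).le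

end Doctrines

variable {S : Signature.{u}} {Γ Δ : List (Ty S)} {σ τ ρ : Ty S}

/-! ### Substitution -/

/-- Weakening by one fresh variable, as a substitution of variables. -/
def Sub.wk (Γ : List (Ty S)) (σ : Ty S) : Sub (σ :: Γ) Γ := fun _ v => .var (.s v)

theorem Tm.wk_eq_subst (M : Tm Γ τ) (σ : Ty S) : M.wk σ = M.subst (Sub.wk Γ σ) := by
  have h := M.ren_subst (fun _ v => .var v) (fun _ v => .s v : Ren (σ :: Γ) Γ)
  rw [M.subst_var] at h
  exact h

theorem Sub.cons_tail_head (s : Sub Δ (σ :: Γ)) : Sub.cons (fun _ v => s (.s v)) (s .z) = s := by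
  funext τ v
  cases v <;> rfl

theorem Tm.subst_lift_inst (M : Tm (σ :: Γ) τ) (s : Sub Δ Γ) (N : Tm Δ σ) :
    (M.subst (s.lift σ)).inst N = M.subst (s.cons N) := by
  rw [Tm.inst, Tm.subst_subst]
  congr 1
  funext τ v
  cases v with
  | z => rfl
  | s v => exact (s v).wk_inst N

theorem Tm.ren_lift_inst_var (M : Tm (σ :: Γ) τ) :
    (M.ren (Ren.lift (fun _ v => .s v) σ)).inst (.var .z) = M := by
  have h : (fun τ (v : Var (σ :: Γ) τ) => Sub.cons (fun _ w => .var w) (.var .z)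
      (Ren.lift (fun _ w => .s w : Ren (σ :: Γ) Γ) σ v)) = fun _ v => .var v := by
    funext τ v
    cases v <;> rfl
  rw [Tm.inst, Tm.subst_ren, h, Tm.subst_var]

theorem Tm.inst_wk_inst (T : Tm (σ :: τ :: Γ) ρ) (M : Tm Γ σ) (N : Tm Γ τ) :
    (T.inst (M.wk τ)).inst N = T.subst ((Sub.cons (fun _ v => .var v) N).cons M) := by
  rw [Tm.inst, Tm.inst, Tm.subst_subst, Sub.cons_comp]
  exact congrArg (fun M => T.subst (Sub.cons _ M)) (M.wk_inst N)

theorem Tm.subst_one_subst (M : Tm [σ] τ) (N : Tm Γ σ) (s : Sub Δ Γ) :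
    (M.subst (.one N)).subst s = M.subst (.one (N.subst s)) := by
  rw [Tm.subst_subst, Sub.one_comp]

theorem Tm.subst_one_var (M : Tm [σ] τ) : M.subst (.one (.var .z)) = M := by
  rw [Sub.one_var, Tm.subst_var]

theorem Tm.wk_eq_subst_one (M : Tm [σ] τ) (ρ : Ty S) :
    M.wk ρ = M.subst (.one (.var (.s .z))) := by
  rw [Tm.wk_eq_subst]
  conv_lhs => rw [← M.subst_one_var, Tm.subst_one_subst]
  rfl

/-! ### Derived rules -/

section DerivedRules

variable {Φ Ψ : List (Fm Γ)}

theorem Der.hyp {φ : Fm Γ} : Der Γ (φ :: Φ) φ := .ax List.mem_cons_self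

theorem Der.wk {φ : Fm Γ} (h : Der Γ Φ φ) (σ : Ty S) :
    Der (σ :: Γ) (Φ.map fun χ => χ.wk σ) (φ.wk σ) := by
  simpa only [Tm.wk_eq_subst] using Der.subst (Sub.wk Γ σ) h

theorem Der.multicut {ψ : Fm Γ} (hΦ : ∀ φ ∈ Φ, Der Γ Ψ φ) (h : Der Γ Φ ψ) : Der Γ Ψ ψ := by
  induction Φ generalizing ψ with
  | nil => exact h.nil
  | cons φ Φ ih =>
    obtain ⟨hφ, hΦ⟩ := List.forall_mem_cons.1 hΦ
    exact .imp_elim (ih hΦ (.imp_intro h)) hφ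

/-- The conjunction of a list of formulae. -/
def conj (Φ : List (Fm Γ)) : Fm Γ := Φ.foldr .and .top

theorem Der.conj_right_iff : Der Γ Ψ (conj Φ) ↔ ∀ φ ∈ Φ, Der Γ Ψ φ := by
  induction Φ with
  | nil => exact ⟨fun _ _ h => absurd h List.not_mem_nil, fun _ => .top_intro⟩
  | cons φ Φ ih =>
    rw [List.forall_mem_cons, ← ih]
    exact ⟨fun h => ⟨.and_left h, .and_right h⟩, fun h => .and_intro h.1 h.2⟩

theorem Der.conj_left_iff {ψ : Fm Γ} : Der Γ [conj Φ] ψ ↔ Der Γ Φ ψ :=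
  ⟨fun h => h.mp (conj_right_iff.2 fun _ => .ax), Der.multicut (conj_right_iff.1 .hyp)⟩

theorem Der.congr_iff {φ φ' ψ ψ' : Fm Γ} (hφ : Der Γ [] (.eq φ φ')) (hψ : Der Γ [] (.eq ψ ψ')) :
    Der Γ [φ] ψ ↔ Der Γ [φ'] ψ' :=
  ⟨fun h => (Der.eq_iff.1 hψ).1.mp (h.mp (Der.eq_iff.1 hφ).2),
    fun h => (Der.eq_iff.1 hψ).2.mp (h.mp (Der.eq_iff.1 hφ).1)⟩

theorem Der.ex_left_iff {φ : Fm (σ :: Γ)} {ψ : Fm Γ} :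
    Der Γ [.ex φ] ψ ↔ Der (σ :: Γ) [φ] (ψ.wk σ) := by
  refine ⟨fun h => (h.wk σ).mp (.ex_intro (.var .z) ?_),
    fun h => .ex_elim .hyp (.weak (by simp) h)⟩
  rw [Tm.ren_lift_inst_var]
  exact .hyp

theorem Der.all_right_iff {φ : Fm (σ :: Γ)} {ψ : Fm Γ} :
    Der Γ [ψ] (.all φ) ↔ Der (σ :: Γ) [ψ.wk σ] φ := by
  refine ⟨fun h => ?_, fun h => .all_intro h⟩
  have hφ := Der.all_elim (.var .z) (h.wk σ)
  rwa [Tm.ren_lift_inst_var] at hφ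

theorem Der.ex_mono {φ ψ : Fm (σ :: Γ)} (h : Der (σ :: Γ) [φ] ψ) : Der Γ [.ex φ] (.ex ψ) :=
  Der.ex_left_iff.2 ((Der.ex_left_iff.1 .hyp).mp h)

theorem Der.all_mono {φ ψ : Fm (σ :: Γ)} (h : Der (σ :: Γ) [φ] ψ) : Der Γ [.all φ] (.all ψ) :=
  Der.all_right_iff.2 (h.mp (Der.all_right_iff.1 .hyp))

theorem Der.eq_congr₂ {M M' : Tm Γ σ} {N N' : Tm Γ τ} (T : Tm (σ :: τ :: Γ) ρ)
    (hM : Der Γ Φ (.eq M M')) (hN : Der Γ Φ (.eq N N')) :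
    Der Γ Φ (.eq (T.subst ((Sub.cons (fun _ v => .var v) N).cons M))
      (T.subst ((Sub.cons (fun _ v => .var v) N').cons M'))) := by
  have h₁ := hM.eq_congr (T.subst (Sub.lift (Sub.cons (fun _ v => .var v) N) σ))
  have h₂ := hN.eq_congr (T.inst (M'.wk τ))
  rw [Tm.subst_lift_inst, Tm.subst_lift_inst] at h₁
  rw [Tm.inst_wk_inst, Tm.inst_wk_inst] at h₂
  exact h₁.eq_trans h₂

theorem Der.pair_congr {M M' : Tm Γ σ} {N N' : Tm Γ τ} (hM : Der Γ Φ (.eq M M'))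
    (hN : Der Γ Φ (.eq N N')) : Der Γ Φ (.eq (.pair M N) (.pair M' N')) :=
  Der.eq_congr₂ (.pair (.var .z) (.var (.s .z))) hM hN

theorem Der.app_congr {M M' : Tm Γ (.arr σ τ)} {N N' : Tm Γ σ} (hM : Der Γ Φ (.eq M M'))
    (hN : Der Γ Φ (.eq N N')) : Der Γ Φ (.eq (.app M N) (.app M' N')) :=
  Der.eq_congr₂ (.app (.var .z) (.var (.s .z))) hM hN

theorem Der.beta_subst {Φ : List (Fm Δ)} (M : Tm (σ :: Γ) τ) (s : Sub Δ (σ :: Γ)) :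
    Der Δ Φ (.eq (.app ((Tm.lam M).subst fun _ v => s (.s v)) (s .z)) (M.subst s)) := by
  have h := Der.beta (Φ := Φ) (M.subst (Sub.lift (fun _ v => s (.s v)) σ)) (s .z)
  rwa [Tm.subst_lift_inst, Sub.cons_tail_head] at h

/- Replacement exchanges only the first variable of a context, and a substitution into `M` is
turned into one into `λ M`, which has one variable fewer. -/
theorem Der.subst_congr {Φ : List (Fm Δ)} (M : Tm Γ τ) {s t : Sub Δ Γ}
    (h : ∀ ⦃σ : Ty S⦄ (v : Var Γ σ), Der Δ Φ (.eq (s v) (t v))) :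
    Der Δ Φ (.eq (M.subst s) (M.subst t)) := by
  induction Γ generalizing τ with
  | nil =>
    obtain rfl : s = t := by
      funext τ v
      cases v
    exact .eq_refl _
  | cons σ Γ ih =>
    have hlam := ih (.lam M) (s := fun _ v => s (.s v)) (t := fun _ v => t (.s v))
      fun _ v => h (.s v)
    exact (Der.beta_subst M s).eq_symm.eq_trans
      ((Der.app_congr hlam (h .z)).eq_trans (Der.beta_subst M t))

end DerivedRules

/-! ### Contexts as products -/

/-- The tuple of all variables of a context, a term of the product type of the context.
Substituting it for the variable of type `ctxTy Γ` is inverse to `ctxSub Γ`. -/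
def ctxTuple : (Γ : List (Ty S)) → Tm Γ (ctxTy Γ)
  | [] => .star
  | σ :: Γ => .pair ((ctxTuple Γ).wk σ) (.var .z)

theorem Der.ctxSub_subst_ctxTuple (v : Var Γ τ) :
    Der Γ [] (.eq ((ctxSub Γ v).subst (.one (ctxTuple Γ))) (.var v)) := by
  induction v with
  | z => exact .snd_pair _ _
  | @s Γ τ σ v ih =>
    have hfst : Der (σ :: Γ) []
        (.eq (.fst (ctxTuple (σ :: Γ))) ((ctxTuple Γ).subst (Sub.wk Γ σ))) := by
      rw [← Tm.wk_eq_subst]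
      exact .fst_pair _ _
    have hv := Der.subst (Sub.wk Γ σ) ih
    change Der _ [] (.eq (((ctxSub Γ v).subst (.one (ctxTuple Γ))).subst (Sub.wk Γ σ))
      (.var (.s v))) at hv
    rw [Tm.subst_one_subst] at hv
    rw [ctxSub, Tm.subst_one_subst]
    exact (Der.congr_one _ hfst).eq_trans hv

theorem Der.subst_ctxSub_subst_ctxTuple (M : Tm Γ τ) :
    Der Γ [] (.eq ((M.subst (ctxSub Γ)).subst (.one (ctxTuple Γ))) M) := by
  have h := Der.subst_congr M fun _ v => Der.ctxSub_subst_ctxTuple v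
  rwa [M.subst_var, ← M.subst_subst] at h

theorem Der.subst_ctxSub_iff {Φ : List (Fm Γ)} {ψ : Fm Γ} :
    Der [ctxTy Γ] (Φ.map fun φ => φ.subst (ctxSub Γ)) (ψ.subst (ctxSub Γ)) ↔ Der Γ Φ ψ := by
  refine ⟨fun h => ?_, .subst _⟩
  refine (Der.subst_ctxSub_subst_ctxTuple ψ).nil.eq_mp
    (Der.multicut (fun χ hχ => ?_) (Der.subst (.one (ctxTuple Γ)) h))
  rw [List.map_map, List.mem_map] at hχ
  obtain ⟨φ, hφ, rfl⟩ := hχ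
  exact (Der.subst_ctxSub_subst_ctxTuple φ).nil.eq_symm.eq_mp (.ax hφ)

/-! ### Exponentials -/

theorem fst_eq_hom (σ τ : Ty S) : fst σ τ = hom (.fst (.var .z)) := rfl

theorem snd_eq_hom (σ τ : Ty S) : snd σ τ = hom (.snd (.var .z)) := rfl

theorem hom_eq_hom {M N : Tm [σ] τ} (h : Der [σ] [] (.eq M N)) : hom M = hom N :=
  Quotient.sound h

theorem exists_hom_eq (f : σ ⟶ τ) : ∃ M : Tm [σ] τ, hom M = f :=
  Quotient.exists_rep f

theorem lift_hom (M : Tm [ρ] σ) (N : Tm [ρ] τ) : lift (hom M) (hom N) = hom (.pair M N) :=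
  CartesianMonoidalCategory.hom_ext _ _
    ((lift_fst _ _).trans (hom_eq_hom (.fst_pair M N)).symm)
    ((lift_snd _ _).trans (hom_eq_hom (.snd_pair M N)).symm)

theorem whiskerLeft_hom (ρ : Ty S) (M : Tm [σ] τ) :
    ρ ◁ hom M = hom (.pair (.fst (.var .z)) (M.subst (.one (.snd (.var .z))))) := by
  rw [← lift_hom]
  exact CartesianMonoidalCategory.hom_ext _ _ ((whiskerLeft_fst _ _).trans (lift_fst _ _).symm)
    ((whiskerLeft_snd _ _).trans (lift_snd _ _).symm)

/-- The pair of the two variables of a context `x : σ, y : τ`.  Substituting it for the variable of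
type `σ × τ` is inverse to substituting the projections for `x` and `y`. -/
abbrev pairVar (σ τ : Ty S) : Tm [σ, τ] (.prod σ τ) := .pair (.var .z) (.var (.s .z))

theorem Tm.subst_pairVar_subst (M : Tm [.prod σ τ] ρ) (s : Sub Δ [σ, τ]) :
    (M.subst (.one (pairVar σ τ))).subst s = M.subst (.one (.pair (s .z) (s (.s .z)))) :=
  M.subst_one_subst _ _

theorem Der.subst_proj (M : Tm [.prod σ τ] ρ) {Φ : List (Fm [.prod σ τ])} :
    Der _ Φ (.eq (M.subst (.one (.pair (.fst (.var .z)) (.snd (.var .z))))) M) := by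
  have h := Der.congr_one M (Der.pair_eta (Φ := Φ) (.var .z))
  rwa [Tm.subst_one_var] at h

theorem Der.subst_snd_subst_pairVar (M : Tm [τ] ρ) {Φ : List (Fm [σ, τ])} :
    Der [σ, τ] Φ (.eq ((M.subst (.one (.snd (.var .z)))).subst (.one (pairVar σ τ))) (M.wk σ)) := by
  rw [Tm.subst_one_subst, Tm.wk_eq_subst_one]
  exact Der.congr_one M (.snd_pair _ _)

/-- The term `λ x. M(x, y)` of a variable `y`, which represents the transpose of a morphism out of a
product.  The variable of the first factor is bound, to agree with the adjoint of `tensorLeft`. -/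
def Tm.curry (M : Tm [.prod σ τ] ρ) : Tm [τ] (.arr σ ρ) :=
  .lam (M.subst (.one (pairVar σ τ)))

/-- The term `M(π₂ p)(π₁ p)` of a variable `p : σ × τ`, which represents the transpose of a morphism
into a function type. -/
def Tm.uncurry (M : Tm [τ] (.arr σ ρ)) : Tm [.prod σ τ] ρ :=
  .app (M.subst (.one (.snd (.var .z)))) (.fst (.var .z))

theorem Der.uncurry_curry (M : Tm [.prod σ τ] ρ) : Der [.prod σ τ] [] (.eq M.curry.uncurry M) := by
  refine Der.eq_trans (Der.beta_subst (M.subst (.one (pairVar σ τ)))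
    (Sub.cons (.one (.snd (.var .z))) (.fst (.var .z)))) ?_
  rw [Tm.subst_pairVar_subst]
  exact Der.subst_proj M

theorem Der.curry_uncurry (M : Tm [τ] (.arr σ ρ)) : Der [τ] [] (.eq M.uncurry.curry M) :=
  (Der.xi (Der.app_congr (Der.subst_snd_subst_pairVar M) (.fst_pair _ _))).eq_trans (.eta M)

theorem Der.curry_congr {M N : Tm [.prod σ τ] ρ} (h : Der _ [] (.eq M N)) :
    Der _ [] (.eq M.curry N.curry) :=
  .xi (.subst (.one (pairVar σ τ)) h)

theorem Der.uncurry_congr {M N : Tm [τ] (.arr σ ρ)} (h : Der _ [] (.eq M N)) :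
    Der _ [] (.eq M.uncurry N.uncurry) :=
  Der.app_congr (.subst (.one (.snd (.var .z))) h) (.eq_refl _)

/-- The bijection between morphisms `σ × τ ⟶ ρ` and `τ ⟶ (σ → ρ)` given by `λ`-abstraction. -/
def curryEquiv (σ τ ρ : Ty S) : (σ ⊗ τ ⟶ ρ) ≃ (τ ⟶ Ty.arr σ ρ) where
  toFun := Quotient.map Tm.curry fun _ _ => Der.curry_congr
  invFun := Quotient.map Tm.uncurry fun _ _ => Der.uncurry_congr
  left_inv f := by
    obtain ⟨M, rfl⟩ := exists_hom_eq f
    exact hom_eq_hom (Der.uncurry_curry M)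
  right_inv f := by
    obtain ⟨M, rfl⟩ := exists_hom_eq f
    exact hom_eq_hom (Der.curry_uncurry M)

theorem Der.subst_whisker_subst_pairVar (M : Tm [ρ] τ) {υ : Ty S} (N : Tm [.prod σ τ] υ)
    {Φ : List (Fm [σ, ρ])} :
    Der [σ, ρ] Φ (.eq ((N.subst (.one (.pair (.fst (.var .z))
        (M.subst (.one (.snd (.var .z))))))).subst (.one (pairVar σ ρ)))
      ((N.subst (.one (pairVar σ τ))).subst (Sub.lift (.one M) σ))) := by
  rw [Tm.subst_one_subst, Tm.subst_pairVar_subst]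
  exact Der.congr_one N (Der.pair_congr (.fst_pair _ _) (Der.subst_snd_subst_pairVar M))

theorem curryEquiv_whiskerLeft_comp (σ : Ty S) {υ : Ty S} (f : ρ ⟶ τ) (g : σ ⊗ τ ⟶ υ) :
    curryEquiv σ ρ υ (σ ◁ f ≫ g) = f ≫ curryEquiv σ τ υ g := by
  obtain ⟨M, rfl⟩ := exists_hom_eq f
  obtain ⟨N, rfl⟩ := exists_hom_eq g
  rw [whiskerLeft_hom]
  exact hom_eq_hom (.xi (Der.subst_whisker_subst_pairVar M N))

/-- The cartesian closed structure of the classifying category, with the function types as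
exponentials. -/
@[reducible]
def monoidalClosedTy : MonoidalClosed (Ty S) where
  closed σ :=
    { rightAdj := Adjunction.rightAdjointOfEquiv (F := tensorLeft σ) (G_obj := Ty.arr σ)
        (fun τ ρ => curryEquiv σ τ ρ) fun _ _ _ f g => curryEquiv_whiskerLeft_comp σ f g
      adj := Adjunction.adjunctionOfEquivRight _ _ }

/-! ### Quantifiers and equality -/

theorem exists_pred_eq (a : (termDoctrine S).obj (op σ)) : ∃ φ : Fm [σ], pred φ = a :=
  Quotient.exists_rep a

theorem pred_le_pred_iff {φ ψ : Fm [σ]} : pred φ ≤ pred ψ ↔ Der [σ] [φ] ψ := Iff.rfl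

/-- The action on predicates of an operation on formulae that is monotone for derivability. -/
def predMap (F : Fm [σ] → Fm [τ]) (hF : ∀ ⦃φ ψ : Fm [σ]⦄, Der [σ] [φ] ψ → Der [τ] [F φ] (F ψ)) :
    (termDoctrine S).obj (op σ) → (termDoctrine S).obj (op τ) :=
  Quotient.map (sa := termSetoid σ (.prop S)) (sb := termSetoid τ (.prop S)) F
    fun _ _ h => .prop_ext (hF (Der.eq_iff.1 h).1) (hF (Der.eq_iff.1 h).2)

theorem Der.subst_pairVar_iff {φ ψ : Fm [.prod σ τ]} :
    Der [σ, τ] [φ.subst (.one (pairVar σ τ))] (ψ.subst (.one (pairVar σ τ))) ↔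
      Der [.prod σ τ] [φ] ψ := by
  refine ⟨fun h => ?_, .subst _⟩
  have hproj := Der.subst (Sub.cons (.one (.snd (.var .z))) (.fst (.var .z)) :
    Sub [.prod σ τ] [σ, τ]) h
  simp only [List.map_cons, List.map_nil, Tm.subst_pairVar_subst] at hproj
  exact (Der.congr_iff (Der.subst_proj φ) (Der.subst_proj ψ)).1 hproj

/-- The formula `∃ x : σ, φ(x, y)`. -/
def Tm.exPair (φ : Fm [.prod σ τ]) : Fm [τ] := .ex (φ.subst (.one (pairVar σ τ)))

/-- The formula `∀ x : σ, φ(x, y)`. -/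
def Tm.allPair (φ : Fm [.prod σ τ]) : Fm [τ] := .all (φ.subst (.one (pairVar σ τ)))

theorem Der.exPair_left_iff {φ : Fm [.prod σ τ]} {ψ : Fm [τ]} :
    Der [τ] [φ.exPair] ψ ↔ Der [.prod σ τ] [φ] (ψ.subst (.one (.snd (.var .z)))) :=
  Der.ex_left_iff.trans ((Der.congr_iff (.eq_refl _) (Der.subst_snd_subst_pairVar ψ).eq_symm).trans
    Der.subst_pairVar_iff)

theorem Der.allPair_right_iff {φ : Fm [.prod σ τ]} {ψ : Fm [τ]} :
    Der [τ] [ψ] φ.allPair ↔ Der [.prod σ τ] [ψ.subst (.one (.snd (.var .z)))] φ :=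
  Der.all_right_iff.trans ((Der.congr_iff (Der.subst_snd_subst_pairVar ψ).eq_symm
    (.eq_refl _)).trans Der.subst_pairVar_iff)

/-- Existential quantification of predicates along the second projection. -/
def exPred (σ τ : Ty S) : (termDoctrine S).obj (op (σ ⊗ τ)) → (termDoctrine S).obj (op τ) :=
  predMap Tm.exPair fun _ _ h => Der.ex_mono (Der.subst_pairVar_iff.2 h)

/-- Universal quantification of predicates along the second projection. -/
def allPred (σ τ : Ty S) : (termDoctrine S).obj (op (σ ⊗ τ)) → (termDoctrine S).obj (op τ) :=
  predMap Tm.allPair fun _ _ h => Der.all_mono (Der.subst_pairVar_iff.2 h)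

theorem gc_exPred (σ τ : Ty S) :
    GaloisConnection (exPred σ τ) ((termDoctrine S).map (snd σ τ).op) := fun a b => by
  obtain ⟨φ, rfl⟩ := exists_pred_eq a
  obtain ⟨ψ, rfl⟩ := exists_pred_eq b
  exact Der.exPair_left_iff

theorem gc_allPred (σ τ : Ty S) :
    GaloisConnection ((termDoctrine S).map (snd σ τ).op) (allPred σ τ) := fun a b => by
  obtain ⟨φ, rfl⟩ := exists_pred_eq a
  obtain ⟨ψ, rfl⟩ := exists_pred_eq b
  exact Der.allPair_right_iff.symm

theorem exPred_map_whiskerLeft (σ : Ty S) (f : ρ ⟶ τ) (a : (termDoctrine S).obj (op (σ ⊗ τ))) :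
    exPred σ ρ ((termDoctrine S).map (σ ◁ f).op a) = (termDoctrine S).map f.op (exPred σ τ a) := by
  obtain ⟨M, rfl⟩ := exists_hom_eq f
  obtain ⟨φ, rfl⟩ := exists_pred_eq a
  rw [whiskerLeft_hom]
  have h := Der.eq_iff.1 (Der.subst_whisker_subst_pairVar M φ)
  exact le_antisymm (Der.ex_mono h.1) (Der.ex_mono h.2)

theorem allPred_map_whiskerLeft (σ : Ty S) (f : ρ ⟶ τ) (a : (termDoctrine S).obj (op (σ ⊗ τ))) :
    allPred σ ρ ((termDoctrine S).map (σ ◁ f).op a) =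
      (termDoctrine S).map f.op (allPred σ τ a) := by
  obtain ⟨M, rfl⟩ := exists_hom_eq f
  obtain ⟨φ, rfl⟩ := exists_pred_eq a
  rw [whiskerLeft_hom]
  have h := Der.eq_iff.1 (Der.subst_whisker_subst_pairVar M φ)
  exact le_antisymm (Der.all_mono h.1) (Der.all_mono h.2)

theorem isHyperdoctrine_term (S : Signature.{u}) : IsHyperdoctrine (termDoctrine S) where
  exists_ex := ⟨exPred, gc_exPred, fun σ _ _ f a => exPred_map_whiskerLeft σ f a,
    fun σ τ a b => frobenius_of_galoisConnection (gc_exPred σ τ)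
      (Term.reindex (snd σ τ)).map_himp' a b⟩
  exists_all := ⟨allPred, gc_allPred, fun σ _ _ f a => allPred_map_whiskerLeft σ f a⟩

theorem Der.of_subst_diag {ψ : Fm [.prod ρ (.prod σ σ)]} {Φ : List (Fm [.prod ρ (.prod σ σ)])}
    (h : Der _ Φ (ψ.subst (.one (.pair (.fst (.var .z))
      (.pair (.fst (.snd (.var .z))) (.fst (.snd (.var .z))))))))
    (heq : Der _ Φ (.eq (.fst (.snd (.var .z))) (.snd (.snd (.var .z))))) : Der _ Φ ψ := by
  have hsnd := (Der.pair_congr (.eq_refl _) heq).eq_trans (.pair_eta _)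
  have hpair := Der.pair_congr (.eq_refl (.fst (.var .z))) hsnd
  exact ((Der.congr_one ψ hpair).eq_trans (Der.subst_proj ψ)).eq_mp h

theorem isFiberedEquality_term (σ : Ty S) : IsFiberedEquality (termDoctrine S) σ
    (pred (σ := .prod σ σ) (.eq (.fst (.var .z)) (.snd (.var .z)))) := by
  refine IsFiberedEquality.of_refl_of_replacement ?_ fun ρ b => ?_
  · have hdiag : lift (𝟙 σ) (𝟙 σ) = hom (.pair (.var .z) (.var .z)) := lift_hom _ _
    rw [hdiag]
    exact top_le_iff.1 ((Der.fst_pair _ _).eq_trans (Der.snd_pair _ _).eq_symm)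
  · obtain ⟨ψ, rfl⟩ := exists_pred_eq b
    rw [fst_eq_hom, snd_eq_hom, lift_hom, whiskerLeft_hom]
    exact Der.of_subst_diag (.and_left .hyp) (.and_right .hyp)

theorem isClosureOperator_term (S : Signature.{u}) :
    IsClosureOperator (termDoctrine S) (termClosure S) where
  monotone σ a b h := by
    obtain ⟨φ, rfl⟩ := exists_pred_eq a
    obtain ⟨ψ, rfl⟩ := exists_pred_eq b
    exact Der.cl_two h
  inflationary σ a := by
    obtain ⟨φ, rfl⟩ := exists_pred_eq a
    exact Der.cl_one .hyp
  continuous f a := by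
    obtain ⟨M, rfl⟩ := exists_hom_eq f
    obtain ⟨φ, rfl⟩ := exists_pred_eq a
    exact le_refl (pred (.cl (φ.subst (.one M))))

theorem isElementaryClosureHyperdoctrine_term (S : Signature.{u}) :
    IsElementaryClosureHyperdoctrine (termDoctrine S) (termClosure S) where
  hyperdoctrine := isHyperdoctrine_term S
  elementary σ := ⟨_, isFiberedEquality_term σ⟩
  closure := isClosureOperator_term S

/-! ### Satisfaction and the generic model -/

section Satisfaction

variable {D : Type w} [Category.{u} D] {Q : Dᵒᵖ ⥤ HeytAlg.{u}} {M : Ty S ⥤ D}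

theorem satisfies_iff_app_conj_le (μ : termDoctrine S ⟶ M.op ⋙ Q) {Φ : List (Fm [σ])}
    {ψ : Fm [σ]} :
    Satisfies Q M μ σ Φ ψ ↔ μ.app (op σ) (pred (conj Φ)) ≤ μ.app (op σ) (pred ψ) := by
  have hconj : (Φ.map fun φ => μ.app (op σ) (pred φ)).foldr (· ⊓ ·) ⊤ =
      μ.app (op σ) (pred (conj Φ)) := by
    induction Φ with
    | nil => exact (map_top (μ.app (op σ)).hom).symm
    | cons φ Φ ih =>
      rw [List.map_cons, List.foldr_cons, ih]
      exact (map_inf (μ.app (op σ)).hom (pred φ) (pred (conj Φ))).symm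
  rw [Satisfies, hconj]

theorem Der.satisfies (μ : termDoctrine S ⟶ M.op ⋙ Q) {Φ : List (Fm [σ])} {ψ : Fm [σ]}
    (h : Der [σ] Φ ψ) : Satisfies Q M μ σ Φ ψ :=
  (satisfies_iff_app_conj_le μ).2 <|
    OrderHomClass.mono (μ.app (op σ)).hom (pred_le_pred_iff.2 (Der.conj_left_iff.2 h))

theorem Der.satisfiesCtx (μ : termDoctrine S ⟶ M.op ⋙ Q) {Φ : List (Fm Γ)} {ψ : Fm Γ}
    (h : Der Γ Φ ψ) : SatisfiesCtx Q M μ Γ Φ ψ :=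
  Der.satisfies μ (Der.subst_ctxSub_iff.2 h)

end Satisfaction

theorem satisfies_genericTrans_iff {Φ : List (Fm [σ])} {ψ : Fm [σ]} :
    Satisfies (termDoctrine S) (𝟭 (Ty S)) (genericTrans S) σ Φ ψ ↔ Der [σ] Φ ψ :=
  (satisfies_iff_app_conj_le _).trans Der.conj_left_iff

theorem satisfiesCtx_genericTrans_iff {Φ : List (Fm Γ)} {ψ : Fm Γ} :
    SatisfiesCtx (termDoctrine S) (𝟭 (Ty S)) (genericTrans S) Γ Φ ψ ↔ Der Γ Φ ψ :=
  satisfies_genericTrans_iff.trans Der.subst_ctxSub_iff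

theorem isModel_generic (S : Signature.{u}) [MonoidalClosed (Ty S)] :
    IsModel (termDoctrine S) (termClosure S) (𝟭 (Ty S)) (genericTrans S) where
  toIsMorphism := .of_app_eq_self _ _ fun _ _ => rfl
  target := isElementaryClosureHyperdoctrine_term S
  representable := ⟨Ty.prop S, ⟨{ homEquiv := Equiv.refl _, homEquiv_comp := fun _ _ => rfl }⟩,
    ⟨Iso.refl _⟩⟩
  preservesExponentials :=
    cartesianClosedFunctorOfLeftAdjointPreservesBinaryProducts (𝟭 (Ty S)) Adjunction.id
  isOpen _ _ := rfl

end SLCS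

open SLCS in
theorem mainTheorem3 (S : Signature.{u}) :
    -- the classifying category (which has finite products) is cartesian closed
    Nonempty (MonoidalClosed (Ty S)) ∧
    -- terms of type `Prop`, with `[φ] ↦ [C(φ)]`, form an (elementary) closure hyperdoctrine
    (∀ (σ : Ty S) (φ : Fm [σ]), termClosure S σ (pred φ) = pred (.cl φ)) ∧
    IsElementaryClosureHyperdoctrine (termDoctrine S) (termClosure S) ∧
    (∀ σ : Ty S, IsFiberedEquality (termDoctrine S) σ
      (pred (σ := .prod σ σ) (.eq (.fst (.var .z)) (.snd (.var .z))))) ∧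
    -- its order is derivability
    (∀ (σ : Ty S) (φ ψ : Fm [σ]), pred φ ≤ pred ψ ↔ Der [σ] [φ] ψ) ∧
    ∀ [MonoidalClosed (Ty S)],
      -- the generic model is a model, and it satisfies exactly the derivable sequents
      IsModel (termDoctrine S) (termClosure S) (𝟭 (Ty S)) (genericTrans S) ∧
      (∀ (σ : Ty S) (Φ : List (Fm [σ])) (ψ : Fm [σ]),
        Satisfies (termDoctrine S) (𝟭 (Ty S)) (genericTrans S) σ Φ ψ ↔ Der [σ] Φ ψ) ∧
      (∀ (Γ : List (Ty S)) (Φ : List (Fm Γ)) (ψ : Fm Γ),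
        SatisfiesCtx (termDoctrine S) (𝟭 (Ty S)) (genericTrans S) Γ Φ ψ ↔ Der Γ Φ ψ) ∧
      -- soundness
      (∀ (D : Type w) [Category.{u} D] [CartesianMonoidalCategory D] [MonoidalClosed D]
        (Q : Dᵒᵖ ⥤ HeytAlg.{u}) (d : ∀ X : D, Q.obj (op X) → Q.obj (op X))
        (M : Ty S ⥤ D) (μ : termDoctrine S ⟶ M.op ⋙ Q), IsModel Q d M μ →
        (∀ (σ : Ty S) (Φ : List (Fm [σ])) (ψ : Fm [σ]), Der [σ] Φ ψ → Satisfies Q M μ σ Φ ψ) ∧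
        (∀ (Γ : List (Ty S)) (Φ : List (Fm Γ)) (ψ : Fm Γ),
          Der Γ Φ ψ → SatisfiesCtx Q M μ Γ Φ ψ)) ∧
      -- completeness
      (∀ (σ : Ty S) (Φ : List (Fm [σ])) (ψ : Fm [σ]),
        (∀ (D : Type u) [Category.{u} D] [CartesianMonoidalCategory D] [MonoidalClosed D]
          (Q : Dᵒᵖ ⥤ HeytAlg.{u}) (d : ∀ X : D, Q.obj (op X) → Q.obj (op X))
          (M : Ty S ⥤ D) (μ : termDoctrine S ⟶ M.op ⋙ Q), IsModel Q d M μ →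
          Satisfies Q M μ σ Φ ψ) → Der [σ] Φ ψ) ∧
      (∀ (Γ : List (Ty S)) (Φ : List (Fm Γ)) (ψ : Fm Γ),
        (∀ (D : Type u) [Category.{u} D] [CartesianMonoidalCategory D] [MonoidalClosed D]
          (Q : Dᵒᵖ ⥤ HeytAlg.{u}) (d : ∀ X : D, Q.obj (op X) → Q.obj (op X))
          (M : Ty S ⥤ D) (μ : termDoctrine S ⟶ M.op ⋙ Q), IsModel Q d M μ →
          SatisfiesCtx Q M μ Γ Φ ψ) → Der Γ Φ ψ) := by
  refine ⟨⟨monoidalClosedTy⟩, fun _ _ => rfl, isElementaryClosureHyperdoctrine_term S,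
    isFiberedEquality_term, fun _ _ _ => pred_le_pred_iff, ?_⟩
  intro _
  have hgeneric := isModel_generic S
  refine ⟨hgeneric, fun _ _ _ => satisfies_genericTrans_iff,
    fun _ _ _ => satisfiesCtx_genericTrans_iff, ?soundness, ?completeness, ?completenessCtx⟩
  case soundness =>
    exact fun _ _ _ _ _ _ _ μ _ =>
      ⟨fun _ _ _ h => h.satisfies μ, fun _ _ _ h => h.satisfiesCtx μ⟩
  case completeness =>
    exact fun _ _ _ h => satisfies_genericTrans_iff.1 (h _ _ _ _ _ hgeneric)
  case completenessCtx =>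
    exact fun _ _ _ h => satisfiesCtx_genericTrans_iff.1 (h _ _ _ _ _ hgeneric)
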